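/- Let $d\ge 1$ and write $L^2=L^2([0,1]^d)$. For $n\ge1$ and $f\in L^2$ let $P_f=P_f^n$ (with expectation $E_f$) be the law of the observation $Y$ in the Gaussian white noise model $dY_x=f(x)\,dx+n^{-1/2}\,dW_x$, $x\in[0,1]^d$, that is, of the process $Y=(Y_g)_{g\in L^2}$ with $Y_g=\langle f,g\rangle_{L^2}+n^{-1/2}W_g$, where $(W_g)_{g\in L^2}$ is a centred Gaussian process with $E[W_gW_h]=\langle g,h\rangle_{L^2}$. Let $\mathcal G$ be the class of all functions $f_0(x)=h\big(\sum_{i=1}^d g_i(x_i)\big)$ on $[0,1]^d$ such that $g_1,\dots,g_d:[0,1]\to\mathbb R$ and $h:\mathbb R\to\mathbb R$ are Lipschitz continuous with Lipschitz constants at most $1$ and $\|g_1\|_{L^\infty[0,1]},\dots,\|g_d\|_{L^\infty[0,1]},\|h\|_{L^\infty(\mathbb R)}\le 1$. Let $(\Pi_n)_n$ be any sequence of mean-zero Gaussian process priors on $L^2$, that is, centred Gaussian Borel probability measures on $L^2$. Then, for every $n\ge 2(d+2)!$, the posterior mean $\bar f_n=E^{\Pi_n}[f\mid Y]$ satisfies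 $$\sup_{f_0\in\mathcal G}E_{f_0}\|\bar f_n-f_0\|_{L^2}\ \ge\ C_d'\,n^{-\frac{2+d}{4+4d}},\qquad C_d'=\frac1{2^{d+1}}\Big(\frac1{2(d+2)!}\Big)^{\frac d{4+4d}}.$$ -/

import Mathlib

open MeasureTheory ProbabilityTheory
open scoped ENNReal NNReal RealInnerProductSpace Nat

noncomputable section

namespace GPRegression

/-- Lebesgue measure on the unit cube `[0,1]^d`. -/
abbrev cubeMeasure (d : ℕ) : Measure (Fin d → ℝ) := volume.restrict (Set.Icc 0 1)

/-- The real Hilbert space `L²([0,1]^d)`. -/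
abbrev L2Cube (d : ℕ) : Type := Lp ℝ 2 (cubeMeasure d)

/-- `L²([0,1]^d)` carries its Borel σ-algebra. -/
instance instMeasurableSpaceL2Cube (d : ℕ) : MeasurableSpace (L2Cube d) := borel _

instance instBorelSpaceL2Cube (d : ℕ) : BorelSpace (L2Cube d) := ⟨rfl⟩

instance instFactTwoNeTop : Fact ((2 : ℝ≥0∞) ≠ ∞) := ⟨ENNReal.ofNat_ne_top⟩

/-- Generalized additive functions `x ↦ h (g₁ x₁ + ⋯ + g_d x_d)` on `[0,1]^d`, where
`g_i : [0,1] → ℝ` and `h : ℝ → ℝ` are `Λ`-Lipschitz and bounded by `Λ` in absolute value;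
seen as a subset of `L²([0,1]^d)`. -/
def gamClass (d : ℕ) (Λ : ℝ≥0) : Set (L2Cube d) :=
  {f | ∃ (g : Fin d → ℝ → ℝ) (h : ℝ → ℝ),
    (∀ i, LipschitzOnWith Λ (g i) (Set.Icc 0 1)) ∧ LipschitzWith Λ h ∧
    (∀ i, ∀ t ∈ Set.Icc (0 : ℝ) 1, |g i t| ≤ Λ) ∧ (∀ u, |h u| ≤ Λ) ∧
    f =ᵐ[cubeMeasure d] fun x ↦ h (∑ i, g i (x i))}

variable {Ω : Type*} [MeasurableSpace Ω]

/-- `W` is Gaussian white noise on `[0,1]^d`: a centred Gaussian process indexed by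
`L²([0,1]^d)` (think of `W g = ∫ g dW`) with covariance `E[W g * W h] = ⟪g, h⟫`. -/
structure IsWhiteNoise {d : ℕ} (W : L2Cube d → Ω → ℝ) (P : Measure Ω) : Prop where
  measurable : ∀ g, Measurable (W g)
  isGaussianProcess : IsGaussianProcess W P
  mean : ∀ g, ∫ ω, W g ω ∂P = 0
  covariance : ∀ g h, ∫ ω, W g ω * W h ω ∂P = ⟪g, h⟫

/-- The observation `Y g = ∫ g dY = ⟪f, g⟫ + n^{-1/2} W g`, `g ∈ L²([0,1]^d)`, in the white noise
model `dY = f dx + n^{-1/2} dW`. -/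
def observation {d : ℕ} (W : L2Cube d → Ω → ℝ) (n : ℕ) (f : L2Cube d) (ω : Ω) : L2Cube d → ℝ :=
  fun g ↦ ⟪f, g⟫ + (1 / √(n : ℝ)) * W g ω

lemma measurable_observation {d : ℕ} {W : L2Cube d → Ω → ℝ} (hW : ∀ g, Measurable (W g)) (n : ℕ) :
    Measurable fun p : L2Cube d × Ω ↦ observation W n p.1 p.2 := by
  refine measurable_pi_iff.2 fun g ↦ ?_
  unfold observation
  have h1 : Measurable fun f : L2Cube d ↦ ⟪f, g⟫ := by
    have : Continuous fun f : L2Cube d ↦ ⟪f, g⟫ := by fun_prop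
    exact this.measurable
  exact (h1.comp measurable_fst).add (((hW g).comp measurable_snd).const_mul _)

/-- The white noise model with sample size `n`, as a Markov kernel from the parameter space
`L²([0,1]^d)` to the space of data: it sends `f` to the law `P_f` of the observation `Y`. -/
def whiteNoiseModel {d : ℕ} {W : L2Cube d → Ω → ℝ} {P : Measure Ω} [IsProbabilityMeasure P]
    (hW : IsWhiteNoise W P) (n : ℕ) : Kernel (L2Cube d) (L2Cube d → ℝ) where
  toFun f := P.map (observation W n f)
  measurable' := by
    refine Measure.measurable_of_measurable_coe _ fun s hs ↦ ?_
    have hm := measurable_observation hW.measurable n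
    have : (fun f ↦ P.map (observation W n f) s) =
        fun f ↦ P (Prod.mk f ⁻¹' ((fun p : L2Cube d × Ω ↦ observation W n p.1 p.2) ⁻¹' s)) := by
      funext f
      exact Measure.map_apply (hm.comp measurable_prodMk_left) hs
    rw [this]
    exact measurable_measure_prodMk_left (hm hs)

instance instIsMarkovKernelWhiteNoiseModel {d : ℕ} {W : L2Cube d → Ω → ℝ} {P : Measure Ω}
    [IsProbabilityMeasure P] (hW : IsWhiteNoise W P) (n : ℕ) :
    IsMarkovKernel (whiteNoiseModel hW n) where
  isProbabilityMeasure _ := Measure.isProbabilityMeasure_map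
    ((measurable_observation hW.measurable n).comp measurable_prodMk_left).aemeasurable

/-- The posterior mean `E[f | Y = y]`, the mean of the Bayes posterior `posterior model prior` on
`L²([0,1]^d)`. -/
def posteriorMean {d : ℕ} {W : L2Cube d → Ω → ℝ} {P : Measure Ω} [IsProbabilityMeasure P]
    (hW : IsWhiteNoise W P) (n : ℕ) (prior : Measure (L2Cube d)) [IsFiniteMeasure prior]
    (y : L2Cube d → ℝ) : L2Cube d :=
  ∫ f, f ∂(posterior (whiteNoiseModel hW n) prior y)

/-- The `L²`-risk `E_{f₀} ‖f̄_n - f₀‖` of the posterior mean `f̄_n` at the true function `f₀`. -/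
def risk {d : ℕ} {W : L2Cube d → Ω → ℝ} {P : Measure Ω} [IsProbabilityMeasure P]
    (hW : IsWhiteNoise W P) (n : ℕ) (prior : Measure (L2Cube d)) [IsFiniteMeasure prior]
    (f₀ : L2Cube d) : ℝ≥0∞ :=
  ∫⁻ y, ‖posteriorMean hW n prior y - f₀‖ₑ ∂(whiteNoiseModel hW n f₀)

end GPRegression

end

/-!
The proof reduces the risk of the posterior mean to a few scalar coordinates, in which it is an
affine function of the data.

*Linearity.* Let `Λ` be the covariance operator of the prior, `ψ ∈ L²`, and let `u` solve
`Λ u + u / n = Λ ψ` (Lax–Milgram). For `f` drawn from the prior, `⟪ψ, f⟫ - Y u` is uncorrelated with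
every `Y g`, hence, everything being jointly Gaussian, independent of the whole process `Y`. So
`⟪ψ, posteriorMean y⟫ = y u` for almost every `y` under the marginal law of the data
(`inner_posteriorMean_ae_eq`). All the laws `P_f` are mutually absolutely continuous
(`whiteNoiseModel_absolutelyContinuous`), so this also holds `P_{f₀}`-almost surely for every `f₀`,
whichever version of the posterior is used.

*Lower bound.* Let `ψ₁, …, ψ_N` be orthonormal with `c • ψ_j` in the class, `u_j` the corresponding
elements, and let `r` bound the risk on the class. At `f₀ = c • ψ_j` the bias in the direction `ψ_j`
gives `c * |1 - ⟪ψ_j, u_j⟫| ≤ r`. At `f₀ = 0` the noise in the `N` directions together gives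
`∑ ‖u_j‖ / √2 ≤ √(n * N) * r`. A linear rule cannot make both small, since
`⟪ψ_j, u_j⟫ ≤ ‖u_j‖`: one gets `1 ≤ r * (1 / c + √2 * √(n / N))` (`one_le_mul_of_orthonormal`).

*The functions.* On a grid of `N = M ^ d` cells of side `1 / M`, the cones
`x ↦ max (δ - ∑ |x i - c i|) 0`, `δ = 1 / (2 * M)`, at the centres of the cells are generalized
additive, are nonzero on disjoint `ℓ¹`-balls, and have squared norm
`1 / (2 * (d + 2)! * M ^ (d + 2))`. The theorem follows by taking `M` of order
`(n / (2 * (d + 2)!)) ^ (1 / (2 * d + 2))`, which balances the two terms.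
-/

namespace GPRegression

variable {d : ℕ} {Ω : Type*} [MeasurableSpace Ω] {P : Measure Ω} {W : L2Cube d → Ω → ℝ}

/-! ### White noise and its shifts -/

/-- The prior and the noise are jointly Gaussian: on the product space, functions of the form
`⟪b, f⟫ + c * W s` make up a Gaussian process. -/
lemma isGaussianProcess_inner_add_mul (prior : Measure (L2Cube d)) [IsGaussian prior]
    (hW : IsGaussianProcess W P) {T : Type*} (b s : T → L2Cube d) (c : T → ℝ) :
    IsGaussianProcess (fun t (p : L2Cube d × Ω) ↦ ⟪b t, p.1⟫ + c t * W (s t) p.2)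
      (prior.prod P) where
  hasGaussianLaw I := by
    classical
    have := hW.isProbabilityMeasure
    set J := I.image s with hJ
    have h1 : HasGaussianLaw (fun p : L2Cube d × Ω ↦ p.1) (prior.prod P) :=
      ⟨by rw [Measure.map_fst_prod]; simpa⟩
    have hWJ := hW.hasGaussianLaw J
    have h2 : HasGaussianLaw (fun p : L2Cube d × Ω ↦ J.restrict (W · p.2)) (prior.prod P) := by
      refine ⟨?_⟩
      have : (fun p : L2Cube d × Ω ↦ J.restrict (W · p.2))
          = (fun ω ↦ J.restrict (W · ω)) ∘ Prod.snd := rfl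
      rw [this, ← AEMeasurable.map_map_of_aemeasurable _ measurable_snd.aemeasurable,
        Measure.map_snd_prod]
      · simpa using hWJ.isGaussian_map
      · rw [Measure.map_snd_prod]; simpa using hWJ.aemeasurable
    have hind : IndepFun (fun p : L2Cube d × Ω ↦ p.1)
        (fun p : L2Cube d × Ω ↦ J.restrict (W · p.2)) (prior.prod P) :=
      indepFun_prod₀ (X := id) (Y := fun ω ↦ J.restrict (W · ω)) aemeasurable_id hWJ.aemeasurable
    have h3 := IndepFun.hasGaussianLaw h1 h2 hind
    let L : L2Cube d × (J → ℝ) →L[ℝ] (I → ℝ) := ContinuousLinearMap.pi fun i ↦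
      (innerSL ℝ (b i)).comp (ContinuousLinearMap.fst ℝ _ _) +
        c i • (ContinuousLinearMap.proj ⟨s i, Finset.mem_image_of_mem s i.2⟩ :
          (J → ℝ) →L[ℝ] ℝ).comp (ContinuousLinearMap.snd ℝ _ _)
    exact h3.map_fun L

lemma memLp_two_noise (hW : IsWhiteNoise W P) (g : L2Cube d) : MemLp (W g) 2 P :=
  (hW.isGaussianProcess.hasGaussianLaw_eval g).memLp_two

lemma covariance_noise [IsProbabilityMeasure P] (hW : IsWhiteNoise W P) (g h : L2Cube d) :
    cov[W g, W h; P] = ⟪g, h⟫ := by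
  rw [covariance_eq_sub (memLp_two_noise hW g) (memLp_two_noise hW h), hW.mean, hW.mean]
  simp [hW.covariance]

lemma map_noise [IsProbabilityMeasure P] (hW : IsWhiteNoise W P) (g : L2Cube d) :
    P.map (W g) = gaussianReal 0 (‖g‖₊ ^ 2) := by
  rw [(hW.isGaussianProcess.hasGaussianLaw_eval g).map_eq_gaussianReal, hW.mean,
    ← covariance_self (hW.measurable g).aemeasurable, covariance_noise hW]
  congr
  ext
  simp

lemma gaussianReal_absolutelyContinuous_gaussianReal (a b : ℝ) {v w : ℝ≥0} (hv : v ≠ 0)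
    (hw : w ≠ 0) : gaussianReal a v ≪ gaussianReal b w :=
  (gaussianReal_absolutelyContinuous a hv).trans (gaussianReal_absolutelyContinuous' b hw)

/-- The laws of the observation under two parameters are mutually absolutely continuous. Splitting
off the component of the noise along `h = f - g`, which is independent of the rest, reduces this
to the equivalence of two nondegenerate Gaussian laws on `ℝ`. -/
lemma whiteNoiseModel_absolutelyContinuous [IsProbabilityMeasure P] (hW : IsWhiteNoise W P)
    {n : ℕ} (hn : n ≠ 0) (f g : L2Cube d) :
    whiteNoiseModel hW n f ≪ whiteNoiseModel hW n g := by
  obtain rfl | hfg := eq_or_ne f g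
  · exact Measure.AbsolutelyContinuous.rfl
  set h := f - g with hh
  have hh0 : ‖h‖ ≠ 0 := by simpa [hh, sub_eq_zero] using hfg
  have hn' : √(n : ℝ) ≠ 0 := by positivity
  set V : L2Cube d → Ω → ℝ := fun u ω ↦ W u ω - ⟪u, h⟫ / ‖h‖ ^ 2 * W h ω with hV
  have mV : ∀ u, Measurable (V u) := fun u ↦
    (hW.measurable u).sub ((hW.measurable h).const_mul _)
  have mV' : Measurable fun ω u ↦ V u ω := measurable_pi_iff.2 mV
  have hind : IndepFun (fun ω (_ : Unit) ↦ W h ω) (fun ω u ↦ V u ω) P := by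
    refine IsGaussianProcess.indepFun_of_covariance_eq_zero (X := fun (_ : Unit) ↦ W h) (Y := V)
      ?_ (fun _ ↦ (hW.measurable h).aemeasurable) (fun u ↦ (mV u).aemeasurable) ?_
    · classical
      refine hW.isGaussianProcess.of_isGaussianProcess fun t ↦ ?_
      cases t with
      | inl t =>
        exact ⟨{h}, (ContinuousLinearMap.proj ⟨h, by simp⟩ :
          (({h} : Finset (L2Cube d)) → ℝ) →L[ℝ] ℝ), fun ω ↦ by simp⟩
      | inr u =>
        exact ⟨{u, h}, (ContinuousLinearMap.proj ⟨u, by simp⟩ - (⟪u, h⟫ / ‖h‖ ^ 2) •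
          ContinuousLinearMap.proj ⟨h, by simp⟩ :
          (({u, h} : Finset (L2Cube d)) → ℝ) →L[ℝ] ℝ), fun ω ↦ by simp [hV]⟩
    · intro _ u
      have : V u = W u - fun ω ↦ ⟪u, h⟫ / ‖h‖ ^ 2 * W h ω := rfl
      rw [this, covariance_sub_right (memLp_two_noise hW h) (memLp_two_noise hW u)
        ((memLp_two_noise hW h).const_mul _), covariance_const_mul_right, covariance_noise hW,
        covariance_noise hW, real_inner_self_eq_norm_sq, real_inner_comm]
      field_simp
      ring
  have hind' : IndepFun (W h) (fun ω u ↦ V u ω) P :=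
    hind.comp (measurable_pi_apply ()) measurable_id
  have hlaw := (indepFun_iff_map_prod_eq_prod_map_map (hW.measurable h).aemeasurable
    mV'.aemeasurable).1 hind'
  rw [map_noise hW] at hlaw
  have hv : ‖h‖₊ ^ 2 ≠ 0 := pow_ne_zero _ (by simpa using hh0)
  let Φ : ℝ × (L2Cube d → ℝ) → L2Cube d → ℝ := fun q u ↦
    ⟪g, u⟫ + (1 / √(n : ℝ)) * (q.2 u + ⟪u, h⟫ / ‖h‖ ^ 2 * q.1)
  have mΦ : Measurable Φ := by
    refine measurable_pi_iff.2 fun u ↦ ?_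
    have : Measurable fun q : ℝ × (L2Cube d → ℝ) ↦ q.2 u :=
      (measurable_pi_apply u).comp measurable_snd
    fun_prop
  -- shifting the parameter from `g` to `f` shifts `W h` by `a` and leaves `V` unchanged
  set a : ℝ := ‖h‖ ^ 2 * √n with ha
  have mpair : Measurable fun ω ↦ (W h ω, fun u ↦ V u ω) := (hW.measurable h).prodMk mV'
  have mshift : Measurable fun q : ℝ × (L2Cube d → ℝ) ↦ (q.1 + a, q.2) := by fun_prop
  have hg : whiteNoiseModel hW n g =
      (P.map fun ω ↦ (W h ω, fun u ↦ V u ω)).map Φ := by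
    rw [Measure.map_map mΦ mpair]
    change P.map _ = _
    congr 1
    ext ω u
    simp [Φ, observation, hV]
  have hf : whiteNoiseModel hW n f =
      ((P.map fun ω ↦ (W h ω, fun u ↦ V u ω)).map fun q ↦ (q.1 + a, q.2)).map Φ := by
    rw [Measure.map_map mΦ mshift, Measure.map_map (mΦ.comp mshift) mpair]
    change P.map _ = _
    congr 1
    ext ω u
    have : ⟪f, u⟫ = ⟪g, u⟫ + ⟪u, h⟫ := by
      rw [hh, inner_sub_right, real_inner_comm u f, real_inner_comm u g]; ring
    simp only [observation, this, Φ, Function.comp, hV, ha]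
    field_simp
    ring
  rw [hf, hg]
  refine Measure.AbsolutelyContinuous.map ?_ mΦ
  have hp : Measure.map (fun q : ℝ × (L2Cube d → ℝ) ↦ (q.1 + a, q.2))
      ((gaussianReal 0 (‖h‖₊ ^ 2)).prod (P.map fun ω u ↦ V u ω))
      = (gaussianReal (0 + a) (‖h‖₊ ^ 2)).prod (P.map fun ω u ↦ V u ω) := by
    have := Measure.isProbabilityMeasure_map (μ := P) mV'.aemeasurable
    rw [← gaussianReal_map_add_const]
    conv_rhs => rw [← Measure.map_id (μ := P.map fun ω u ↦ V u ω)]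
    rw [Measure.map_prod_map _ _ (by fun_prop) measurable_id]
    rfl
  have := Measure.isProbabilityMeasure_map (μ := P) mV'.aemeasurable
  rw [hlaw, hp]
  exact (gaussianReal_absolutelyContinuous_gaussianReal _ _ hv hv).prod
    Measure.AbsolutelyContinuous.rfl

/-- Each `P_f` is absolutely continuous with respect to the marginal law of the data, so the almost
sure properties of the posterior hold under every true parameter. -/
lemma whiteNoiseModel_absolutelyContinuous_comp [IsProbabilityMeasure P] (hW : IsWhiteNoise W P)
    {n : ℕ} (hn : n ≠ 0) (prior : Measure (L2Cube d)) [IsProbabilityMeasure prior]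
    (f : L2Cube d) :
    whiteNoiseModel hW n f ≪ whiteNoiseModel hW n ∘ₘ prior := by
  refine Measure.AbsolutelyContinuous.mk fun s hs h0 ↦ ?_
  rw [Measure.bind_apply hs (Kernel.aemeasurable _),
    lintegral_eq_zero_iff (Kernel.measurable_coe _ hs)] at h0
  obtain ⟨g, hg⟩ := h0.exists
  exact whiteNoiseModel_absolutelyContinuous hW hn f g hg

/-! ### The posterior mean is linear in the data -/

lemma exists_covarianceOperator_add_smul_eq (prior : Measure (L2Cube d)) {c : ℝ} (hc : 0 < c)
    (ψ : L2Cube d) : ∃ u, covarianceOperator prior u + c • u = ψ := by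
  let A : L2Cube d →L[ℝ] L2Cube d := covarianceOperator prior + c • ContinuousLinearMap.id ℝ _
  let B : L2Cube d →L[ℝ] L2Cube d →L[ℝ] ℝ := (innerSL ℝ).comp A
  have hB : IsCoercive B := by
    -- coercive since the covariance operator is positive
    refine ⟨c, hc, fun v ↦ ?_⟩
    have h := (isPositive_covarianceOperator (μ := prior)).re_inner_nonneg_left v
    simp only [B, A, ContinuousLinearMap.comp_apply, innerSL_apply_apply,
      add_apply, smul_apply, ContinuousLinearMap.id_apply,
      inner_add_left, real_inner_smul_left, real_inner_self_eq_norm_sq]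
    simp at h
    nlinarith
  obtain ⟨u, hu⟩ := hB.continuousLinearEquivOfBilin.surjective ψ
  refine ⟨u, ext_inner_right ℝ fun w ↦ ?_⟩
  rw [← hu, hB.continuousLinearEquivOfBilin_apply]
  rfl

lemma compProd_whiteNoiseModel [IsProbabilityMeasure P] (hW : IsWhiteNoise W P)
    (n : ℕ) (prior : Measure (L2Cube d)) [IsProbabilityMeasure prior] :
    prior ⊗ₘ whiteNoiseModel hW n =
      (prior.prod P).map fun p ↦ (p.1, observation W n p.1 p.2) := by
  have hm := measurable_observation hW.measurable n
  ext s hs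
  rw [Measure.compProd_apply hs, Measure.map_apply (measurable_fst.prodMk hm) hs,
    Measure.prod_apply ((measurable_fst.prodMk hm) hs)]
  refine lintegral_congr fun f ↦ ?_
  exact Measure.map_apply (hm.comp measurable_prodMk_left) (measurable_prodMk_left hs)

lemma comp_whiteNoiseModel [IsProbabilityMeasure P] (hW : IsWhiteNoise W P)
    (n : ℕ) (prior : Measure (L2Cube d)) [IsProbabilityMeasure prior] :
    whiteNoiseModel hW n ∘ₘ prior =
      (prior.prod P).map fun p ↦ observation W n p.1 p.2 := by
  have hm := measurable_observation hW.measurable n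
  rw [← Measure.snd_compProd, compProd_whiteNoiseModel, Measure.snd,
    Measure.map_map measurable_snd (measurable_fst.prodMk hm)]
  rfl

lemma covariance_inner_add_mul [IsProbabilityMeasure P] (hW : IsWhiteNoise W P)
    (prior : Measure (L2Cube d)) [IsGaussian prior] (hprior : ∫ f, f ∂prior = 0)
    (a b u v : L2Cube d) (s t : ℝ) :
    cov[fun p : L2Cube d × Ω ↦ ⟪a, p.1⟫ + s * W u p.2,
      fun p : L2Cube d × Ω ↦ ⟪b, p.1⟫ + t * W v p.2; prior.prod P] =
      ⟪covarianceOperator prior a, b⟫ + s * t * ⟪u, v⟫ := by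
  have hf : ∀ a, MemLp (fun p : L2Cube d × Ω ↦ ⟪a, p.1⟫) 2 (prior.prod P) := fun a ↦ by
    have : MemLp (fun f : L2Cube d ↦ ⟪a, f⟫) 2 prior :=
      (IsGaussian.memLp_two_id (μ := prior)).const_inner a
    exact this.comp_fst P
  have hw : ∀ u, MemLp (fun p : L2Cube d × Ω ↦ W u p.2) 2 (prior.prod P) := fun u ↦
    (memLp_two_noise hW u).comp_snd prior
  have e1 : cov[fun p : L2Cube d × Ω ↦ ⟪a, p.1⟫, fun p : L2Cube d × Ω ↦ ⟪b, p.1⟫;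
      prior.prod P] = ⟪covarianceOperator prior a, b⟫ := by
    rw [covarianceOperator_inner IsGaussian.memLp_two_id]
    have hmean : ∀ a : L2Cube d, ∫ p, ⟪a, p.1⟫ ∂(prior.prod P) = 0 := fun a ↦ by
      rw [integral_fun_fst (fun f : L2Cube d ↦ ⟪a, f⟫)]
      have := integral_inner (𝕜 := ℝ) (IsGaussian.integrable_id (μ := prior)) a
      simp_all
    rw [covariance_eq_sub (hf a) (hf b), hmean, hmean]
    simp only [Pi.mul_apply]
    rw [integral_fun_fst (fun f : L2Cube d ↦ ⟪a, f⟫ * ⟪b, f⟫)]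
    simp
  have e2 : ∀ a v, cov[fun p : L2Cube d × Ω ↦ ⟪a, p.1⟫, fun p : L2Cube d × Ω ↦ W v p.2;
      prior.prod P] = 0 := fun a v ↦
    (indepFun_prod (X := fun f : L2Cube d ↦ ⟪a, f⟫) (Y := W v) (by fun_prop)
      (hW.measurable v)).covariance_eq_zero (hf a) (hw v)
  have e3 : cov[fun p : L2Cube d × Ω ↦ W u p.2, fun p : L2Cube d × Ω ↦ W v p.2;
      prior.prod P] = ⟪u, v⟫ := by
    rw [covariance_eq_sub (hw u) (hw v), integral_fun_snd (W u), integral_fun_snd (W v)]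
    simp only [Pi.mul_apply]
    rw [integral_fun_snd (fun ω ↦ W u ω * W v ω)]
    simp [hW.covariance, hW.mean]
  have key := covariance_add_left (μ := prior.prod P) (hf a) ((hw u).const_mul s)
    ((hf b).add ((hw v).const_mul t))
  rw [covariance_add_right (hf a) (hf b) ((hw v).const_mul t),
    covariance_add_right ((hw u).const_mul s) (hf b) ((hw v).const_mul t),
    covariance_const_mul_right, covariance_const_mul_left, covariance_const_mul_left,
    covariance_const_mul_right, e1, e2, e3,
    covariance_comm (fun p : L2Cube d × Ω ↦ W u p.2), e2] at key
  refine Eq.trans key ?_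
  ring

/-- The coordinates of the posterior mean are values of the observed process: `u` is chosen so that
`⟪ψ, f⟫ - Y u` is uncorrelated with, hence independent of, the data `Y`. -/
lemma inner_posteriorMean_ae_eq [IsProbabilityMeasure P] (hW : IsWhiteNoise W P)
    {n : ℕ} (prior : Measure (L2Cube d)) [IsGaussian prior]
    (hprior : ∫ f, f ∂prior = 0) {ψ u : L2Cube d}
    (hu : covarianceOperator prior u + (1 / (n : ℝ)) • u = covarianceOperator prior ψ) :
    ∀ᵐ y ∂(whiteNoiseModel hW n ∘ₘ prior), ⟪ψ, posteriorMean hW n prior y⟫ = y u := by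
  have hm := measurable_observation hW.measurable n
  set κ := whiteNoiseModel hW n with hκ
  set Y : L2Cube d × Ω → L2Cube d → ℝ := fun p ↦ observation W n p.1 p.2 with hY
  set U : L2Cube d × Ω → ℝ := fun p ↦ ⟪ψ, p.1⟫ - Y p u with hU
  have hYeq : ∀ g, (fun p ↦ Y p g) = fun p ↦ ⟪g, p.1⟫ + (1 / √(n : ℝ)) * W g p.2 := fun g ↦ by
    ext p; simp [hY, observation, real_inner_comm]
  have hUeq : U = fun p ↦ ⟪ψ - u, p.1⟫ + (-(1 / √(n : ℝ))) * W u p.2 := by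
    ext p
    have : Y p u = ⟪u, p.1⟫ + (1 / √(n : ℝ)) * W u p.2 := congrFun (hYeq u) p
    simp only [hU, this, inner_sub_left]
    ring
  have hint1 : ∀ a, Integrable (fun p : L2Cube d × Ω ↦ ⟪a, p.1⟫) (prior.prod P) := fun a ↦ by
    have : Integrable (fun f : L2Cube d ↦ ⟪a, f⟫) prior :=
      (IsGaussian.integrable_id (μ := prior)).const_inner a
    exact this.comp_fst P
  have hint2 : ∀ g, Integrable (fun p : L2Cube d × Ω ↦ W g p.2) (prior.prod P) := fun g ↦
    ((memLp_two_noise hW g).integrable one_le_two).comp_snd prior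
  have hintY : ∀ g, Integrable (fun p ↦ Y p g) (prior.prod P) := fun g ↦ by
    rw [hYeq]; exact (hint1 g).add ((hint2 g).const_mul _)
  have hintU : Integrable U (prior.prod P) := (hint1 ψ).sub (hintY u)
  have hU0 : ∫ p, U p ∂(prior.prod P) = 0 := by
    rw [hUeq, integral_add (hint1 _) ((hint2 _).const_mul _), integral_const_mul,
      integral_fun_snd (W u), integral_fun_fst (fun f : L2Cube d ↦ ⟪ψ - u, f⟫), hW.mean]
    have := integral_inner (𝕜 := ℝ) (IsGaussian.integrable_id (μ := prior)) (ψ - u)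
    simp_all
  have mU : Measurable U := by
    have : Measurable fun p ↦ Y p u := (measurable_pi_apply u).comp hm
    exact Measurable.sub (by fun_prop) this
  have hind : IndepFun U Y (prior.prod P) := by
    have h0 : IndepFun (fun p (_ : Unit) ↦ U p) (fun p g ↦ Y p g) (prior.prod P) := by
      refine IsGaussianProcess.indepFun_of_covariance_eq_zero (X := fun (_ : Unit) ↦ U)
        (Y := fun g p ↦ Y p g) ?_ (fun _ ↦ mU.aemeasurable)
        (fun g ↦ ((measurable_pi_apply g).comp hm).aemeasurable) ?_
      · convert! isGaussianProcess_inner_add_mul prior hW.isGaussianProcess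
          (T := Unit ⊕ L2Cube d) (Sum.elim (fun _ ↦ ψ - u) id) (Sum.elim (fun _ ↦ u) id)
          (Sum.elim (fun _ ↦ -(1 / √(n : ℝ))) (fun _ ↦ 1 / √(n : ℝ))) using 1
        ext t p
        cases t with
        | inl t => simp [hUeq]
        | inr g => simpa using congrFun (hYeq g) p
      · intro _ g
        rw [hUeq, hYeq, covariance_inner_add_mul hW prior hprior]
        have hs : -(1 / √(n : ℝ)) * (1 / √(n : ℝ)) = -(1 / (n : ℝ)) := by
          rw [neg_mul, div_mul_div_comm, Real.mul_self_sqrt n.cast_nonneg, one_mul]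
        rw [hs, map_sub, ← hu, add_sub_cancel_left, real_inner_smul_left]
        ring
    exact h0.comp (measurable_pi_apply ()) measurable_id
  -- the two sides have the same integral over every measurable set of data
  set m := κ ∘ₘ prior with hmdef
  have hmY : m = (prior.prod P).map Y := comp_whiteNoiseModel hW n prior
  have hjoint : m ⊗ₘ (posterior κ prior) = (prior.prod P).map fun p ↦ (Y p, p.1) := by
    rw [compProd_posterior_eq_map_swap, compProd_whiteNoiseModel,
      Measure.map_map measurable_swap (measurable_fst.prodMk hm)]
    rfl
  have mpair : Measurable fun p : L2Cube d × Ω ↦ (Y p, p.1) := hm.prodMk measurable_fst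
  have hintf : Integrable (fun q : (L2Cube d → ℝ) × L2Cube d ↦ q.2) (m ⊗ₘ posterior κ prior) := by
    rw [hjoint, integrable_map_measure (by fun_prop) mpair.aemeasurable]
    exact (IsGaussian.integrable_id (μ := prior)).comp_fst P
  have hae : ∀ᵐ y ∂m, Integrable (fun f ↦ f) (posterior κ prior y) := hintf.ae_of_compProd
  have hae' : ∀ᵐ y ∂m, ⟪ψ, posteriorMean hW n prior y⟫ = ∫ f, ⟪ψ, f⟫ ∂(posterior κ prior y) := by
    filter_upwards [hae] with y hy
    exact (integral_inner (𝕜 := ℝ) hy ψ).symm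
  have hintψ : Integrable (fun q : (L2Cube d → ℝ) × L2Cube d ↦ ⟪ψ, q.2⟫)
      (m ⊗ₘ posterior κ prior) := hintf.const_inner ψ
  have hinty : Integrable (fun y : L2Cube d → ℝ ↦ y u) m := by
    rw [hmY, integrable_map_measure (measurable_pi_apply u).aestronglyMeasurable hm.aemeasurable]
    exact hintY u
  suffices (fun y ↦ ∫ f, ⟪ψ, f⟫ ∂(posterior κ prior y)) =ᵐ[m] fun y ↦ y u by
    filter_upwards [hae', this] with y h1 h2 using h1.trans h2
  refine Integrable.ae_eq_of_forall_setIntegral_eq _ _ (Integrable.integral_compProd (a := ()) hintψ) hinty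
    fun A hA _ ↦ ?_
  have h1 := Measure.setIntegral_compProd (μ := m) (κ := posterior κ prior) hA MeasurableSet.univ
    hintψ.integrableOn
  simp only [Measure.restrict_univ] at h1
  rw [← h1, hjoint, setIntegral_map (hA.prod .univ) (by fun_prop) mpair.aemeasurable, hmY,
    setIntegral_map hA (measurable_pi_apply u).aestronglyMeasurable hm.aemeasurable]
  have hpre : (fun p : L2Cube d × Ω ↦ (Y p, p.1)) ⁻¹' (A ×ˢ Set.univ) = Y ⁻¹' A := by
    ext; simp
  rw [hpre, ← sub_eq_zero, ← integral_sub (hint1 ψ).integrableOn (hintY u).integrableOn]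
  change ∫ p in Y ⁻¹' A, U p ∂(prior.prod P) = 0
  have hA' : MeasurableSet (Y ⁻¹' A) := hm hA
  rw [← integral_indicator hA']
  have h2 : IndepFun U ((A.indicator fun _ ↦ (1 : ℝ)) ∘ Y) (prior.prod P) :=
    hind.comp measurable_id (measurable_const.indicator hA)
  have h3 := h2.integral_fun_mul_eq_mul_integral mU.aestronglyMeasurable
    ((measurable_const.indicator hA).comp hm).aestronglyMeasurable
  rw [hU0, zero_mul] at h3
  rw [← h3]
  congr 1
  ext p
  by_cases hp : Y p ∈ A <;> simp [hp]

/-! ### Orthogonal cones in the class of generalized additive functions -/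

/-- The cone of height `δ` over the `ℓ¹`-ball of radius `δ` around `c`. -/
def l1Cone (δ : ℝ) (c x : Fin d → ℝ) : ℝ := max (δ - ∑ i, |x i - c i|) 0

lemma continuous_l1Cone (δ : ℝ) (c : Fin d → ℝ) : Continuous (l1Cone δ c) := by
  unfold l1Cone; fun_prop

lemma l1Cone_nonneg (δ : ℝ) (c x : Fin d → ℝ) : 0 ≤ l1Cone δ c x := le_max_right _ _

lemma l1Cone_le {δ : ℝ} (hδ : 0 ≤ δ) (c x : Fin d → ℝ) : l1Cone δ c x ≤ δ :=
  max_le (sub_le_self _ (Finset.sum_nonneg fun _ _ ↦ abs_nonneg _)) hδ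

lemma l1Cone_eq_zero_of_le_abs {δ : ℝ} {c x : Fin d → ℝ} (i : Fin d) (h : δ ≤ |x i - c i|) :
    l1Cone δ c x = 0 := by
  refine max_eq_right (sub_nonpos.2 (h.trans ?_))
  exact Finset.single_le_sum (f := fun i ↦ |x i - c i|) (fun _ _ ↦ abs_nonneg _)
    (Finset.mem_univ i)

lemma integral_max_sub_abs_pow (δ : ℝ) {m : ℕ} (hm : m ≠ 0) :
    ∫ t : ℝ, max (δ - |t|) 0 ^ m = 2 / (m + 1) * max δ 0 ^ (m + 1) := by
  rw [integral_comp_abs (f := fun t ↦ max (δ - t) 0 ^ m)]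
  obtain hδ | hδ := le_or_gt δ 0
  · rw [setIntegral_eq_zero_of_forall_eq_zero]
    · simp [hδ]
    · intro t ht
      rw [Set.mem_Ioi] at ht
      rw [max_eq_right (by linarith), zero_pow hm]
  · have h1 : ∫ t in Set.Ioi (0 : ℝ), max (δ - t) 0 ^ m =
        ∫ t in Set.Ioc 0 δ, max (δ - t) 0 ^ m := by
      refine setIntegral_eq_of_subset_of_forall_sdiff_eq_zero measurableSet_Ioi
        Set.Ioc_subset_Ioi_self fun t ht ↦ ?_
      have : δ < t := by
        by_contra! h
        exact ht.2 ⟨ht.1, h⟩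
      rw [max_eq_right (by linarith), zero_pow hm]
    have h2 : ∫ t in Set.Ioc 0 δ, max (δ - t) 0 ^ m = ∫ t in (0 : ℝ)..δ, (δ - t) ^ m := by
      rw [intervalIntegral.integral_of_le hδ.le]
      refine setIntegral_congr_fun measurableSet_Ioc fun t ht ↦ ?_
      rw [max_eq_left (by linarith [ht.2])]
    rw [h1, h2, intervalIntegral.integral_comp_sub_left (fun t ↦ t ^ m), integral_pow,
      max_eq_left hδ.le]
    simp
    ring

lemma lintegral_max_sub_abs_pow (δ : ℝ) {m : ℕ} (hm : m ≠ 0) :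
    ∫⁻ t : ℝ, ENNReal.ofReal (max (δ - |t|) 0 ^ m) =
      ENNReal.ofReal (2 / (m + 1) * max δ 0 ^ (m + 1)) := by
  rw [← integral_max_sub_abs_pow δ hm, ofReal_integral_eq_lintegral_ofReal]
  · refine Continuous.integrable_of_hasCompactSupport (by fun_prop) ?_
    refine HasCompactSupport.of_support_subset_isCompact (isCompact_Icc (a := -δ) (b := δ))
      fun t ht ↦ ?_
    rw [Set.mem_Icc, ← abs_le]
    by_contra! h
    exact ht (by simp only; rw [max_eq_right (by linarith), zero_pow hm])
  · exact Filter.Eventually.of_forall fun t ↦ by positivity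

/-- By Tonelli and induction on the dimension: integrating out `d` of `d + 1` coordinates leaves a
multiple of the one-dimensional cone to the power `d + 2`. -/
lemma lintegral_max_sub_sum_abs_sq (d : ℕ) (δ : ℝ) :
    ∫⁻ x : Fin d → ℝ, ENNReal.ofReal (max (δ - ∑ i, |x i|) 0 ^ 2) =
      ENNReal.ofReal (2 ^ (d + 1) / (d + 2)! * max δ 0 ^ (d + 2)) := by
  induction d generalizing δ with
  | zero => simp [volume_pi, Nat.factorial]
  | succ d ih =>
    have hmp := (volume_preserving_piFinSuccAbove (fun _ : Fin (d + 1) ↦ ℝ) 0).symm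
    rw [← hmp.lintegral_comp_emb (MeasurableEquiv.measurableEmbedding _),
      Measure.volume_eq_prod, lintegral_prod _ (by fun_prop)]
    have : ∀ t : ℝ, ∫⁻ y : Fin d → ℝ, ENNReal.ofReal
        (max (δ - ∑ i, |(MeasurableEquiv.piFinSuccAbove (fun _ : Fin (d + 1) ↦ ℝ) 0).symm
          (t, y) i|) 0 ^ 2) =
        ENNReal.ofReal (2 ^ (d + 1) / (d + 2)!) *
          ENNReal.ofReal (max (δ - |t|) 0 ^ (d + 2)) := fun t ↦ by
      rw [← ENNReal.ofReal_mul (by positivity), ← ih]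
      refine lintegral_congr fun y ↦ ?_
      rw [Fin.sum_univ_succ]
      simp [MeasurableEquiv.piFinSuccAbove, sub_sub]
    simp_rw [this]
    rw [lintegral_const_mul _ (by fun_prop), lintegral_max_sub_abs_pow _ (by omega),
      ← ENNReal.ofReal_mul (by positivity)]
    congr 1
    rw [show (d + 1 + 2)! = (d + 2 + 1) * (d + 2)! from rfl]
    push_cast
    field_simp
    ring

lemma memLp_l1Cone {δ : ℝ} (hδ : 0 ≤ δ) (c : Fin d → ℝ) :
    MemLp (l1Cone δ c) 2 (cubeMeasure d) := by
  have : IsFiniteMeasure (cubeMeasure d) := ⟨by simpa using isCompact_Icc.measure_lt_top⟩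
  refine MemLp.of_bound (continuous_l1Cone δ c).aestronglyMeasurable δ
    (Filter.Eventually.of_forall fun x ↦ ?_)
  rw [Real.norm_of_nonneg (l1Cone_nonneg δ c x)]
  exact l1Cone_le hδ c x

lemma integral_l1Cone_sq {δ : ℝ} (hδ : 0 ≤ δ) {c : Fin d → ℝ} (h0 : ∀ i, δ ≤ c i)
    (h1 : ∀ i, c i + δ ≤ 1) :
    ∫ x, l1Cone δ c x ^ 2 ∂(cubeMeasure d) = 2 ^ (d + 1) / (d + 2)! * δ ^ (d + 2) := by
  rw [integral_eq_lintegral_of_nonneg_ae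
    (Filter.Eventually.of_forall fun x ↦ by positivity)
    (by have := continuous_l1Cone δ c; fun_prop)]
  have hsupp : Function.support (fun x ↦ ENNReal.ofReal (l1Cone δ c x ^ 2)) ⊆ Set.Icc 0 1 := by
    intro x hx
    contrapose! hx
    rw [Function.notMem_support]
    obtain ⟨i, hi⟩ : ∃ i, ¬ (0 ≤ x i ∧ x i ≤ 1) := by
      by_contra! h
      exact hx ⟨fun i ↦ (h i).1, fun i ↦ (h i).2⟩
    have : δ ≤ |x i - c i| := by
      rw [le_abs]
      by_contra! h
      exact hi ⟨by linarith [h0 i], by linarith [h1 i]⟩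
    simp [l1Cone_eq_zero_of_le_abs i this]
  rw [setLIntegral_eq_of_support_subset hsupp]
  have := lintegral_sub_right_eq_self (μ := (volume : Measure (Fin d → ℝ)))
    (fun x ↦ ENNReal.ofReal (max (δ - ∑ i, |x i|) 0 ^ 2)) c
  simp only [Pi.sub_apply, lintegral_max_sub_sum_abs_sq] at this
  simp only [l1Cone, this]
  rw [ENNReal.toReal_ofReal (by positivity), max_eq_left hδ]

/-- The cone is `h (∑ i, |x i - c i|)` for `h u = max (δ - max u 0) 0`. -/
lemma toLp_l1Cone_mem_gamClass {δ : ℝ} (hδ : 0 ≤ δ) (hδ1 : δ ≤ 1) {c : Fin d → ℝ}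
    (h0 : ∀ i, 0 ≤ c i) (h1 : ∀ i, c i ≤ 1) :
    (memLp_l1Cone hδ c).toLp ∈ gamClass d 1 := by
  refine ⟨fun i t ↦ |t - c i|, fun u ↦ max (δ - max u 0) 0, fun i ↦ ?_, ?_, fun i t ht ↦ ?_,
    fun u ↦ ?_, ?_⟩
  · refine LipschitzWith.lipschitzOnWith (LipschitzWith.of_dist_le_mul fun x y ↦ ?_)
    simp only [Real.dist_eq, NNReal.coe_one, one_mul]
    refine (abs_abs_sub_abs_le _ _).trans (le_of_eq ?_)
    congr 1; ring
  -- cutting `u` off at `0` keeps `h` bounded on all of `ℝ`, and does not matter for `u ≥ 0`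
  · refine LipschitzWith.max_const (LipschitzWith.of_dist_le_mul fun x y ↦ ?_) 0
    simp only [Real.dist_eq, NNReal.coe_one, one_mul, sub_sub_sub_cancel_left]
    rw [abs_sub_comm x y]
    exact abs_max_sub_max_le_abs y x 0
  · rw [abs_abs, NNReal.coe_one, abs_le]
    constructor <;> linarith [ht.1, ht.2, h0 i, h1 i]
  · rw [NNReal.coe_one, abs_of_nonneg (le_max_right _ _)]
    refine max_le ?_ zero_le_one
    linarith [le_max_right u 0]
  · filter_upwards [(memLp_l1Cone hδ c).coeFn_toLp] with x hx
    rw [hx, max_eq_left (Finset.sum_nonneg fun _ _ ↦ abs_nonneg _)]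
    rfl

/-- The normalized cones over the `M ^ d` cells of the regular grid. -/
lemma exists_orthonormal_smul_mem_gamClass (d : ℕ) {M : ℕ} (hM : M ≠ 0) :
    ∃ ψ : (Fin d → Fin M) → L2Cube d, Orthonormal ℝ ψ ∧
      ∀ j, √(1 / (2 * (d + 2)! * (M : ℝ) ^ (d + 2))) • ψ j ∈ gamClass d 1 := by
  have hM0 : (0 : ℝ) < M := by positivity
  have hM1 : (1 : ℝ) ≤ M := by exact_mod_cast Nat.one_le_iff_ne_zero.2 hM
  set δ : ℝ := 1 / (2 * M) with hδdef
  have hδ : 0 ≤ δ := by positivity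
  let c : (Fin d → Fin M) → Fin d → ℝ := fun j i ↦ (2 * (j i : ℕ) + 1) * δ
  have hMδ : 2 * M * δ = 1 := by rw [hδdef]; field_simp
  have hc0 : ∀ j i, δ ≤ c j i := fun j i ↦ by
    have : (0 : ℝ) ≤ (j i : ℕ) := Nat.cast_nonneg _
    simp only [c]
    nlinarith
  have hc1 : ∀ j i, c j i + δ ≤ 1 := fun j i ↦ by
    have : ((j i : ℕ) : ℝ) + 1 ≤ M := by exact_mod_cast (j i).2
    simp only [c]
    nlinarith
  set s : ℝ := √(1 / (2 * (d + 2)! * (M : ℝ) ^ (d + 2))) with hs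
  have hs0 : 0 < s := by positivity
  have hs2 : s ^ 2 = 2 ^ (d + 1) / (d + 2)! * δ ^ (d + 2) := by
    rw [hs, Real.sq_sqrt (by positivity), hδdef, div_pow, one_pow, mul_pow]
    field_simp
    ring
  let b : (Fin d → Fin M) → L2Cube d := fun j ↦ (memLp_l1Cone hδ (c j)).toLp
  have hinner : ∀ j k, ⟪b j, b k⟫ =
      ∫ x, l1Cone δ (c j) x * l1Cone δ (c k) x ∂(cubeMeasure d) := fun j k ↦ by
    rw [L2.inner_def]
    refine integral_congr_ae ?_
    filter_upwards [(memLp_l1Cone hδ (c j)).coeFn_toLp, (memLp_l1Cone hδ (c k)).coeFn_toLp]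
      with x hj hk
    simp only [b, hj, hk]
    simp [mul_comm]
  have horth : ∀ j k, ⟪b j, b k⟫ = if j = k then s ^ 2 else 0 := fun j k ↦ by
    rw [hinner]
    split_ifs with hjk
    · subst hjk
      simp only [← sq]
      rw [integral_l1Cone_sq hδ (hc0 j) (hc1 j), hs2]
    · obtain ⟨i, hi⟩ := Function.ne_iff.1 hjk
      refine integral_eq_zero_of_ae (Filter.Eventually.of_forall fun x ↦ ?_)
      -- the centres differ by at least `2 * δ` in coordinate `i`
      have hdist : 2 * δ ≤ |c j i - c k i| := by
        have h1 : (1 : ℝ) ≤ |((j i : ℕ) : ℝ) - (k i : ℕ)| := by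
          have : (1 : ℤ) ≤ |((j i : ℕ) : ℤ) - (k i : ℕ)| :=
            Int.one_le_abs (sub_ne_zero.2 (by exact_mod_cast fun h ↦ hi (Fin.ext h)))
          exact_mod_cast this
        have h2 : c j i - c k i = 2 * δ * (((j i : ℕ) : ℝ) - (k i : ℕ)) := by
          simp only [c]; ring
        rw [h2, abs_mul, abs_of_nonneg (by positivity : 0 ≤ 2 * δ)]
        nlinarith
      have htri : |c j i - c k i| ≤ |x i - c j i| + |x i - c k i| := by
        rw [abs_sub_comm (x i) (c j i)]
        exact abs_sub_le _ _ _
      obtain h | h : δ ≤ |x i - c j i| ∨ δ ≤ |x i - c k i| := by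
        by_contra! h
        linarith [h.1, h.2]
      · simp [l1Cone_eq_zero_of_le_abs i h]
      · simp [l1Cone_eq_zero_of_le_abs i h]
  refine ⟨fun j ↦ s⁻¹ • b j, ?_, fun j ↦ ?_⟩
  · classical
    rw [orthonormal_iff_ite]
    intro j k
    rw [real_inner_smul_left, real_inner_smul_right, horth]
    split_ifs
    · field_simp
    · simp
  · rw [smul_smul, mul_inv_cancel₀ hs0.ne', one_smul]
    refine toLp_l1Cone_mem_gamClass hδ ?_ (fun i ↦ hδ.trans (hc0 j i)) (fun i ↦ ?_)
    · rw [hδdef, div_le_one (by positivity)]; linarith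
    · linarith [hc1 j i]

/-! ### The first absolute moment of the noise -/

lemma integral_abs_gaussianReal {v : ℝ≥0} (hv : v ≠ 0) :
    ∫ x, |x| ∂(gaussianReal 0 v) = √(2 * v / Real.pi) := by
  have hv0 : (0 : ℝ) < v := by positivity
  rw [integral_gaussianReal_eq_integral_smul hv]
  have h : ∀ x : ℝ, gaussianPDFReal 0 v x • |x| =
      (√(2 * Real.pi * v))⁻¹ *
        (|x| ^ (1 : ℝ) * Real.exp (-(1 / (2 * v)) * |x| ^ (2 : ℝ))) := fun x ↦ by
    simp only [gaussianPDFReal_def, sub_zero, smul_eq_mul, Real.rpow_one, Real.rpow_two, sq_abs]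
    rw [mul_assoc, mul_comm |x|]
    congr 3
    ring
  rw [integral_congr_ae (.of_forall h), integral_comp_abs (f := fun t ↦ (√(2 * Real.pi * v))⁻¹ *
    (t ^ (1 : ℝ) * Real.exp (-(1 / (2 * v)) * t ^ (2 : ℝ)))), integral_const_mul,
    integral_rpow_mul_exp_neg_mul_rpow two_pos (by norm_num) (by positivity)]
  norm_num [Real.rpow_neg_one]
  field_simp
  rw [Real.sq_sqrt v.coe_nonneg, Real.sq_sqrt zero_le_two, mul_comm]

lemma norm_div_sqrt_two_le_integral_abs_noise [IsProbabilityMeasure P] (hW : IsWhiteNoise W P)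
    (u : L2Cube d) : ‖u‖ / √2 ≤ ∫ ω, |W u ω| ∂P := by
  obtain rfl | hu := eq_or_ne u 0
  · simpa using integral_nonneg fun ω ↦ abs_nonneg (W 0 ω)
  have h : ∫ ω, |W u ω| ∂P = ∫ x, |x| ∂(P.map (W u)) :=
    (integral_map (hW.measurable u).aemeasurable (by fun_prop)).symm
  rw [h, map_noise hW, integral_abs_gaussianReal (pow_ne_zero _ (by simpa using hu))]
  refine Real.le_sqrt_of_sq_le ?_
  rw [div_pow, Real.sq_sqrt zero_le_two, NNReal.coe_pow, coe_nnnorm,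
    div_le_div_iff₀ two_pos Real.pi_pos]
  -- the exact constant `√(2 / π)` is at least `1 / √2` because `π ≤ 4`
  nlinarith [Real.pi_le_four, sq_nonneg ‖u‖]

lemma lintegral_whiteNoiseModel [IsProbabilityMeasure P] (hW : IsWhiteNoise W P) (n : ℕ)
    (f : L2Cube d) {F : (L2Cube d → ℝ) → ℝ≥0∞} (hF : Measurable F) :
    ∫⁻ y, F y ∂(whiteNoiseModel hW n f) = ∫⁻ ω, F (observation W n f ω) ∂P :=
  lintegral_map hF ((measurable_observation hW.measurable n).comp measurable_prodMk_left)

/-! ### Lower bounds for the risk -/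

lemma ae_inner_posteriorMean_eq [IsProbabilityMeasure P] (hW : IsWhiteNoise W P)
    {n : ℕ} (hn : n ≠ 0) (prior : Measure (L2Cube d)) [IsGaussian prior]
    (hprior : ∫ f, f ∂prior = 0) (ψ : L2Cube d) :
    ∃ u : L2Cube d, ∀ f₀, ∀ᵐ y ∂(whiteNoiseModel hW n f₀),
      ⟪ψ, posteriorMean hW n prior y⟫ = y u := by
  obtain ⟨u, hu⟩ := exists_covarianceOperator_add_smul_eq prior
    (c := 1 / (n : ℝ)) (by positivity) (covarianceOperator prior ψ)
  exact ⟨u, fun f₀ ↦ (whiteNoiseModel_absolutelyContinuous_comp hW hn prior f₀).ae_le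
    (inner_posteriorMean_ae_eq hW prior hprior hu)⟩

/-- The risk is at least the bias of the coordinate of the posterior mean in the direction `ψ`. -/
lemma ofReal_abs_bias_le_risk [IsProbabilityMeasure P] (hW : IsWhiteNoise W P)
    {n : ℕ} (prior : Measure (L2Cube d)) [IsFiniteMeasure prior] {ψ u f₀ : L2Cube d}
    (hψ : ‖ψ‖ ≤ 1) (hu : ∀ᵐ y ∂(whiteNoiseModel hW n f₀),
      ⟪ψ, posteriorMean hW n prior y⟫ = y u) :
    ENNReal.ofReal |⟪f₀, u⟫ - ⟪ψ, f₀⟫| ≤ risk hW n prior f₀ := by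
  have hint : Integrable (W u) P := (memLp_two_noise hW u).integrable one_le_two
  have hint' : Integrable (fun ω ↦ ⟪f₀, u⟫ + 1 / √(n : ℝ) * W u ω) P :=
    (integrable_const _).add (hint.const_mul _)
  calc ENNReal.ofReal |⟪f₀, u⟫ - ⟪ψ, f₀⟫|
      = ENNReal.ofReal |∫ ω, (observation W n f₀ ω u - ⟪ψ, f₀⟫) ∂P| := by
        simp only [observation]
        rw [integral_sub hint' (integrable_const _),
          integral_add (integrable_const _) (hint.const_mul _), integral_const_mul, hW.mean]
        simp
    _ ≤ ∫⁻ ω, ‖observation W n f₀ ω u - ⟪ψ, f₀⟫‖ₑ ∂P := by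
        rw [← Real.norm_eq_abs, ofReal_norm]
        exact enorm_integral_le_lintegral_enorm _
    _ = ∫⁻ y, ‖y u - ⟪ψ, f₀⟫‖ₑ ∂(whiteNoiseModel hW n f₀) :=
        (lintegral_whiteNoiseModel hW n f₀
          ((measurable_pi_apply u).sub_const _).enorm).symm
    _ ≤ risk hW n prior f₀ := by
        refine lintegral_mono_ae ?_
        filter_upwards [hu] with y hy
        rw [← hy, ← inner_sub_right, enorm_le_iff_norm_le]
        refine (norm_inner_le_norm _ _).trans ?_
        exact mul_le_of_le_one_left (norm_nonneg _) hψ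

lemma sum_abs_inner_le {ι : Type*} [Fintype ι] {ψ : ι → L2Cube d} (hψ : Orthonormal ℝ ψ)
    (z : L2Cube d) : ∑ j, |⟪ψ j, z⟫| ≤ √(Fintype.card ι) * ‖z‖ := by
  have h1 := hψ.sum_inner_products_le z (s := Finset.univ)
  have h2 := sq_sum_le_card_mul_sum_sq (s := Finset.univ) (f := fun j ↦ |⟪ψ j, z⟫|)
  simp only [Real.norm_eq_abs] at h1
  refine le_of_sq_le_sq ?_ (by positivity)
  rw [mul_pow, Real.sq_sqrt (Nat.cast_nonneg _)]
  exact h2.trans (mul_le_mul_of_nonneg_left h1 (Nat.cast_nonneg _))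

/-- At `f₀ = 0` the posterior mean is pure noise; its total size in `N` orthonormal directions is at
most `√N` times its norm. -/
lemma ofReal_sum_norm_le_risk_zero [IsProbabilityMeasure P] (hW : IsWhiteNoise W P)
    {n : ℕ} (prior : Measure (L2Cube d)) [IsFiniteMeasure prior] {ι : Type*} [Fintype ι]
    {ψ u : ι → L2Cube d} (hψ : Orthonormal ℝ ψ)
    (hu : ∀ j, ∀ᵐ y ∂(whiteNoiseModel hW n 0), ⟪ψ j, posteriorMean hW n prior y⟫ = y (u j)) :
    ENNReal.ofReal (1 / √n * ∑ j, ‖u j‖ / √2) ≤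
      ENNReal.ofReal √(Fintype.card ι) * risk hW n prior 0 := by
  have hint : ∀ j, Integrable (fun ω ↦ |W (u j) ω|) P := fun j ↦
    ((memLp_two_noise hW (u j)).integrable one_le_two).abs
  have hobs : ∀ ω j, |observation W n 0 ω (u j)| = 1 / √n * |W (u j) ω| := fun ω j ↦ by
    simp only [observation, inner_zero_left, zero_add, abs_mul]
    rw [abs_of_nonneg (by positivity : 0 ≤ 1 / √(n : ℝ))]
  calc ENNReal.ofReal (1 / √n * ∑ j, ‖u j‖ / √2)
      ≤ ENNReal.ofReal (∫ ω, 1 / √n * ∑ j, |W (u j) ω| ∂P) := by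
        refine ENNReal.ofReal_le_ofReal ?_
        rw [integral_const_mul, integral_finsetSum _ fun j _ ↦ hint j]
        gcongr with j
        exact norm_div_sqrt_two_le_integral_abs_noise hW (u j)
    _ = ∫⁻ ω, ENNReal.ofReal (∑ j, |observation W n 0 ω (u j)|) ∂P := by
        simp only [hobs, ← Finset.mul_sum]
        exact ofReal_integral_eq_lintegral_ofReal
          ((integrable_finsetSum _ fun j _ ↦ hint j).const_mul _)
          (.of_forall fun ω ↦ by positivity)
    _ = ∫⁻ y, ENNReal.ofReal (∑ j, |y (u j)|) ∂(whiteNoiseModel hW n 0) :=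
        (lintegral_whiteNoiseModel hW n 0 (F := fun y ↦ ENNReal.ofReal (∑ j, |y (u j)|))
          (by fun_prop)).symm
    _ ≤ ∫⁻ y, ENNReal.ofReal √(Fintype.card ι) * ‖posteriorMean hW n prior y - 0‖ₑ
          ∂(whiteNoiseModel hW n 0) := by
        refine lintegral_mono_ae ?_
        filter_upwards [ae_all_iff.2 hu] with y hy
        simp only [← hy]
        rw [sub_zero, ← ofReal_norm, ← ENNReal.ofReal_mul (by positivity)]
        exact ENNReal.ofReal_le_ofReal (sum_abs_inner_le hψ _)
    _ = ENNReal.ofReal √(Fintype.card ι) * risk hW n prior 0 :=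
        lintegral_const_mul' _ _ ENNReal.ofReal_ne_top

lemma zero_mem_gamClass (d : ℕ) (Λ : ℝ≥0) : 0 ∈ gamClass d Λ := by
  refine ⟨fun _ _ ↦ 0, fun _ ↦ 0, fun _ ↦ LipschitzWith.lipschitzOnWith (LipschitzWith.const' 0),
    LipschitzWith.const' 0, by simp, by simp, ?_⟩
  exact Lp.coeFn_zero _ _ _

/-- The trade-off between bias and noise, for the risk of the posterior mean over a class `S` that
contains `0` and multiples `c • ψ j` of an orthonormal family. -/
lemma one_le_mul_of_orthonormal [IsProbabilityMeasure P] (hW : IsWhiteNoise W P)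
    {n : ℕ} (hn : n ≠ 0) (prior : Measure (L2Cube d)) [IsGaussian prior]
    (hprior : ∫ f, f ∂prior = 0) {ι : Type*} [Fintype ι] [Nonempty ι]
    {ψ : ι → L2Cube d} (hψ : Orthonormal ℝ ψ) {c : ℝ} (hc : 0 < c) {S : Set (L2Cube d)}
    (h0 : 0 ∈ S) (hS : ∀ j, c • ψ j ∈ S) {r : ℝ}
    (hr : ∀ f ∈ S, risk hW n prior f ≤ ENNReal.ofReal r) (hr0 : 0 ≤ r) :
    1 ≤ r * (1 / c + √2 * √(n / Fintype.card ι)) := by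
  choose u hu using fun j ↦ ae_inner_posteriorMean_eq hW hn prior hprior (ψ j)
  have hbias : ∀ j, 1 - r / c ≤ ‖u j‖ := fun j ↦ by
    have h1 := (ofReal_abs_bias_le_risk hW prior (hψ.1 j).le (hu j (c • ψ j))).trans
      (hr _ (hS j))
    rw [ENNReal.ofReal_le_ofReal_iff hr0, real_inner_smul_left, real_inner_smul_right,
      real_inner_self_eq_norm_sq, hψ.1 j] at h1
    have h2 : ⟪ψ j, u j⟫ ≤ ‖u j‖ := by
      simpa [hψ.1 j] using real_inner_le_norm (ψ j) (u j)
    have h3 := (abs_le.1 h1).1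
    have h4 : c * (1 - r / c) ≤ c * ⟪ψ j, u j⟫ := by
      rw [mul_sub, mul_div_cancel₀ _ hc.ne']; linarith
    exact (le_of_mul_le_mul_left h4 hc).trans h2
  have hN : (0 : ℝ) < Fintype.card ι := by exact_mod_cast Fintype.card_pos
  have hn' : (0 : ℝ) < n := by positivity
  have hnoise : 1 / √n * ∑ j, ‖u j‖ / √2 ≤ √(Fintype.card ι) * r := by
    have h := (ofReal_sum_norm_le_risk_zero hW prior hψ fun j ↦ hu j 0).trans
      (mul_le_mul_right (hr 0 h0) _)
    rwa [← ENNReal.ofReal_mul (by positivity), ENNReal.ofReal_le_ofReal_iff (by positivity)] at h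
  have hsum : Fintype.card ι * (1 - r / c) ≤ ∑ j, ‖u j‖ := by
    simpa using Finset.card_nsmul_le_sum Finset.univ (fun j ↦ ‖u j‖) _ fun j _ ↦ hbias j
  rw [← Finset.sum_div] at hnoise
  have h5 : ∑ j, ‖u j‖ ≤ √(Fintype.card ι) * r * √2 * √n := by
    rw [one_div, inv_mul_le_iff₀ (by positivity), div_le_iff₀ (by positivity)] at hnoise
    linarith
  have h6 : (Fintype.card ι : ℝ) * (1 - r / c) ≤
      Fintype.card ι * (r * (√2 * √(n / Fintype.card ι))) := by
    refine hsum.trans (h5.trans (le_of_eq ?_))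
    rw [Real.sqrt_div hn'.le]
    field_simp
    rw [Real.sq_sqrt hN.le, mul_comm]
  have h7 := le_of_mul_le_mul_left h6 hN
  rw [mul_add, mul_one_div]
  linarith

/-! ### The rate -/

/-- With `n = A * m ^ (2 * d + 2)`, the rate is the norm of a cone on a grid of mesh `1 / m`. -/
lemma rate_eq (d : ℕ) {A m : ℝ} (hA : 0 < A) (hm : 0 < m) :
    (1 / A) ^ ((d : ℝ) / (4 + 4 * d)) *
      (A * m ^ (2 * d + 2)) ^ (-((2 + d : ℝ) / (4 + 4 * d))) = √(1 / (A * m ^ (d + 2))) := by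
  have hd : (4 + 4 * (d : ℝ)) ≠ 0 := by positivity
  rw [Real.sqrt_eq_rpow, ← Real.rpow_natCast m, ← Real.rpow_natCast m,
    Real.mul_rpow hA.le (by positivity), ← Real.rpow_mul hm.le, one_div, Real.inv_rpow hA.le,
    one_div (A * _), Real.inv_rpow (by positivity), Real.mul_rpow hA.le (by positivity),
    ← Real.rpow_mul hm.le, ← Real.rpow_neg hA.le, ← mul_assoc, ← Real.rpow_add hA, mul_inv,
    ← Real.rpow_neg hA.le, ← Real.rpow_neg hm.le]
  congr 2
  · field_simp
    ring
  · push_cast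
    field_simp
    ring

lemma one_add_sqrt_two_pow_le {d : ℕ} (hd : 1 ≤ d) : 1 + √2 ^ (d + 1) ≤ (2 : ℝ) ^ (d + 1) := by
  have h1 : (2 : ℝ) ≤ √2 ^ (d + 1) := by
    calc (2 : ℝ) = √2 ^ 2 := (Real.sq_sqrt zero_le_two).symm
      _ ≤ √2 ^ (d + 1) := pow_le_pow_right₀ (Real.one_le_sqrt.2 one_le_two) (by omega)
  have h2 : (2 : ℝ) ^ (d + 1) = √2 ^ (d + 1) * √2 ^ (d + 1) := by
    rw [← mul_pow, Real.mul_self_sqrt zero_le_two]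
  nlinarith

end GPRegression

theorem theorem2 (d : ℕ) (hd : 1 ≤ d)
    {Ω : Type*} [MeasurableSpace Ω] (P : Measure Ω) [IsProbabilityMeasure P]
    (W : GPRegression.L2Cube d → Ω → ℝ) (hW : GPRegression.IsWhiteNoise W P)
    (prior : ℕ → Measure (GPRegression.L2Cube d)) [∀ n, IsGaussian (prior n)]
    (hprior : ∀ n, ∫ f, f ∂(prior n) = 0)
    (n : ℕ) (hn : 2 * (d + 2)! ≤ n) :
    ENNReal.ofReal
        ((1 / 2 ^ (d + 1) * (1 / (2 * ((d + 2)! : ℝ))) ^ ((d : ℝ) / (4 + 4 * d))) *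
          (n : ℝ) ^ (-((2 + d : ℝ) / (4 + 4 * d)))) ≤
      ⨆ f₀ ∈ GPRegression.gamClass d 1, GPRegression.risk hW n (prior n) f₀ := by
  set r := ⨆ f₀ ∈ GPRegression.gamClass d 1, GPRegression.risk hW n (prior n) f₀ with hr
  obtain hr_top | hr_top := eq_or_ne r ∞
  · rw [hr_top]; exact le_top
  set A : ℝ := 2 * ((d + 2)! : ℝ) with hA
  have hA0 : 0 < A := by positivity
  have hAn : A ≤ n := by rw [hA]; exact_mod_cast hn
  have hn0 : (0 : ℝ) < n := hA0.trans_le hAn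
  -- `m` balances the squared bias `1 / (A * m ^ (d + 2))` and the variance `m ^ d / n`
  set m : ℝ := (n / A) ^ ((1 : ℝ) / (2 * d + 2 : ℕ)) with hm
  have hm1 : 1 ≤ m := Real.one_le_rpow ((one_le_div hA0).2 hAn) (by positivity)
  have hm0 : 0 < m := zero_lt_one.trans_le hm1
  have hnm : (n : ℝ) = A * m ^ (2 * d + 2) := by
    rw [hm, one_div, Real.rpow_inv_natCast_pow (by positivity) (by omega)]
    field_simp
  set M := ⌊m⌋₊ with hMdef
  have hM : M ≠ 0 := (Nat.floor_pos.2 hm1).ne'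
  have hMm : (M : ℝ) ≤ m := Nat.floor_le hm0.le
  have hM0 : (0 : ℝ) < M := by positivity
  have hmM : m ≤ 2 * M := by
    have h1 := Nat.lt_floor_add_one m
    have h2 : (1 : ℝ) ≤ M := by exact_mod_cast Nat.one_le_iff_ne_zero.2 hM
    linarith
  set R : ℝ := √(1 / (A * m ^ (d + 2))) with hR
  have hR0 : 0 < R := by positivity
  obtain ⟨ψ, hψ, hmem⟩ := GPRegression.exists_orthonormal_smul_mem_gamClass d hM
  set c : ℝ := √(1 / (A * (M : ℝ) ^ (d + 2))) with hc
  have hc0 : 0 < c := by positivity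
  have hRc : R ≤ c := by
    refine Real.sqrt_le_sqrt ?_
    gcongr
  have : Nonempty (Fin d → Fin M) := ⟨fun _ ↦ ⟨0, Nat.pos_of_ne_zero hM⟩⟩
  have key := GPRegression.one_le_mul_of_orthonormal hW (Nat.cast_ne_zero.1 hn0.ne') (prior n) (hprior n) hψ
    hc0 (GPRegression.zero_mem_gamClass d 1) hmem (r := r.toReal) (fun f hf ↦ by
      rw [ENNReal.ofReal_toReal hr_top]
      exact le_iSup₂_of_le f hf le_rfl) ENNReal.toReal_nonneg
  have hN : √(n / Fintype.card (Fin d → Fin M) : ℝ) ≤ √2 ^ d / R := by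
    have hsq : (√2 ^ d / R) ^ 2 = 2 ^ d * (A * m ^ (d + 2)) := by
      rw [div_pow, hR, Real.sq_sqrt (by positivity), ← pow_mul, mul_comm d 2, pow_mul,
        Real.sq_sqrt zero_le_two]
      field_simp
    refine Real.sqrt_le_iff.2 ⟨by positivity, ?_⟩
    rw [hsq, Fintype.card_fun, Fintype.card_fin, Fintype.card_fin, Nat.cast_pow,
      div_le_iff₀ (by positivity), hnm]
    calc A * m ^ (2 * d + 2) = A * m ^ (d + 2) * m ^ d := by ring
      _ ≤ A * m ^ (d + 2) * (2 * M) ^ d := by gcongr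
      _ = 2 ^ d * (A * m ^ (d + 2)) * M ^ d := by ring
  have hfin : R ≤ r.toReal * 2 ^ (d + 1) := by
    have h1 : 1 / c + √2 * √(n / Fintype.card (Fin d → Fin M) : ℝ) ≤ 2 ^ (d + 1) / R := by
      calc _ ≤ 1 / R + √2 * (√2 ^ d / R) := by gcongr
        _ = (1 + √2 ^ (d + 1)) / R := by ring
        _ ≤ _ := by gcongr; exact GPRegression.one_add_sqrt_two_pow_le hd
    have h2 := key.trans (mul_le_mul_of_nonneg_left h1 ENNReal.toReal_nonneg)
    rwa [mul_div_assoc', le_div_iff₀ hR0, one_mul] at h2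
  refine ENNReal.ofReal_le_of_le_toReal ?_
  rw [mul_assoc, hnm, GPRegression.rate_eq d hA0 hm0, ← hR, one_div, inv_mul_le_iff₀ (by positivity)]
  linarith
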